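/- Let $D\subset\mathbb{C}$ be open, let $\Omega\subset\mathbb{C}$ be a domain (a nonempty connected open set) with $D\subset\Omega$, and let $f:D\to D$ be holomorphic. Let $\mathbb{C}_\infty=\mathbb{C}\cup\{\infty\}$ be the extended complex plane with the chordal metric $\chi$, and let $\partial_\infty\Omega$ be the boundary of $\Omega$ in $\mathbb{C}_\infty$. For an open set $V\subset\mathbb{C}$, let $H(V)$ be the space of holomorphic functions on $V$ with the topology of uniform convergence on compact subsets of $V$. Denote by $f^n$ the $n$-th iterate of $f$, $n\in\mathbb{N}=\{1,2,\dots\}$. Let $U\subset D$ be an open set such that 1. $U$ has no holes, i.e. every connected component of $\mathbb{C}_\infty\setminus U$ contains $\infty$; 2. every iterate $f^n$ is injective on $U$; 3. $f^n\to\partial_\infty\Omega$ locally uniformly on $U$, i.e. the functions $z\mapsto \operatorname{dist}_\chi\big(f^n(z),\partial_\infty\Omega\big)$ converge to $0$ locally uniformly on $U$ as $n\to\infty$. Then the set of all $g\in H(\Omega)$ that are $H(U)$-universal for the composition operator $C_f$, i.e. for which $\{g\circ f^n|_U:n\in\mathbb{N}\}$ is dense in $H(U)$, is comeager in $H(\Omega)$,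 i.e. it contains a dense $G_\delta$-subset of $H(\Omega)$. -/

import Mathlib

open Set Filter Topology

noncomputable section

/-- The space `H(Ω)` of holomorphic functions on `Ω`, as a subset of the space `C(Ω, ℂ)` of
continuous functions, which carries the compact-open topology, that is, the topology of uniform
convergence on compact subsets of `Ω`. -/
def HolFun (Ω : Set ℂ) : Set C(Ω, ℂ) :=
  {g | ∃ G : ℂ → ℂ, DifferentiableOn ℂ G Ω ∧ ∀ z : Ω, g z = G z}

/-- The chordal metric on the extended complex plane `OnePoint ℂ`. -/
def chordal : OnePoint ℂ → OnePoint ℂ → ℝ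
  | OnePoint.some z, OnePoint.some w =>
      2 * ‖z - w‖ / (Real.sqrt (1 + ‖z‖ ^ 2) * Real.sqrt (1 + ‖w‖ ^ 2))
  | OnePoint.some z, OnePoint.infty => 2 / Real.sqrt (1 + ‖z‖ ^ 2)
  | OnePoint.infty, OnePoint.some w => 2 / Real.sqrt (1 + ‖w‖ ^ 2)
  | OnePoint.infty, OnePoint.infty => 0

/-- The chordal distance of a point of the extended plane to a (nonempty) set. -/
def chordalInfDist (x : OnePoint ℂ) (A : Set (OnePoint ℂ)) : ℝ :=
  sInf (chordal x '' A)

/-- A subset of `ℂ`, regarded as a subset of the extended plane. -/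
def toSphere (M : Set ℂ) : Set (OnePoint ℂ) :=
  (fun z : ℂ => (z : OnePoint ℂ)) '' M

/-- The boundary of `Ω ⊆ ℂ` taken in the extended plane. -/
def sphereBoundary (Ω : Set ℂ) : Set (OnePoint ℂ) :=
  frontier (toSphere Ω)

/-- `H` is a hole of `M`: a connected component of the complement of `M` in the extended plane
that does not contain `∞`. -/
def IsHole (M : Set ℂ) (H : Set (OnePoint ℂ)) : Prop :=
  (∃ x ∈ (toSphere M)ᶜ, H = connectedComponentIn (toSphere M)ᶜ x) ∧ OnePoint.infty ∉ H

/-- `M` has no holes. -/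
def HasNoHoles (M : Set ℂ) : Prop :=
  ∀ H, ¬ IsHole M H

/-- The restriction to `M ⊆ D` of the `n`-th iterate of a continuous self-map `f` of `D ⊆ Ω`,
as a continuous map from `M` to `Ω`. -/
def iterateOn {Ω D M : Set ℂ} {f : ℂ → ℂ} (hf : ContinuousOn f D) (hfD : MapsTo f D D)
    (hDΩ : D ⊆ Ω) (hMD : M ⊆ D) (n : ℕ) : C(M, Ω) where
  toFun z := ⟨f^[n] z, hDΩ (hfD.iterate n (hMD z.2))⟩
  continuous_toFun :=
    (continuousOn_iff_continuous_domRestrict.1 ((hf.iterate hfD n).mono hMD)).subtype_mk _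

/-- `g` is `F`-universal for the composition operator with symbol `f`: the family `F` of
continuous functions on `M` is contained in the closure in `C(M, ℂ)` of the set of all
`g ∘ fⁿ|_M`, `n ≥ 1`. -/
def IsUniversal {Ω D M : Set ℂ} {f : ℂ → ℂ} (hf : ContinuousOn f D) (hfD : MapsTo f D D)
    (hDΩ : D ⊆ Ω) (hMD : M ⊆ D) (F : Set C(M, ℂ)) (g : C(Ω, ℂ)) : Prop :=
  F ⊆ closure {φ : C(M, ℂ) | ∃ n : ℕ, 1 ≤ n ∧ φ = g.comp (iterateOn hf hfD hDΩ hMD n)}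

/-- A set is comeager if it contains a dense `Gδ`-set. -/
def IsComeager {X : Type*} [TopologicalSpace X] (S : Set X) : Prop :=
  ∃ T ⊆ S, IsGδ T ∧ Dense T

end

/-! By Baire category, it suffices that for every basic open `V` meeting `H(U)` the open set of all
`g` with `g ∘ fⁿ ∈ V` for some `n ≥ 1` is dense. Density is a simultaneous approximation
(`exists_holomorphic_near`): given compact `K ⊆ Ω` and `L ⊆ U`, find `G ∈ H(Ω)` close to `g₀` on `K`
with `G ∘ fⁿ` close to `h` on `L`. For large `n` the set `fⁿ(L)` misses `K`, since `fⁿ` tends to the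
boundary, and `h ∘ (fⁿ)⁻¹` is holomorphic near `fⁿ(L)` by injectivity. So this is Runge
approximation on `X = K ∪ fⁿ(L)` by functions holomorphic on `Ω`.

Runge's theorem (`exists_mem_eq_of_kernelMem`) reduces it to Cauchy kernels with pole off `X`. The
bad poles, whose kernel is not approximable, form a bounded set contained in `Ω` with boundary in
`X`. A winding argument (`not_hasLogOn_frontier`) shows that no bad pole `z` exists if `(w - z) / ψ
w` has a continuous logarithm on `X` for some continuous `ψ` zero-free on `Ω`. Such logarithms are
found on the two pieces separately: on `K` by moving the pole to a nearby point off `Ω`, and on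
`fⁿ(L)` by pulling back to `L`, where the absence of holes gives every zero-free holomorphic
function a logarithm (`hasLogOn_core`). No component of the complement of `fⁿ(L)` need be examined.
-/

noncomputable section

open Complex MeasureTheory

/-! ### The Cauchy–Pompeiu formula -/

/-- Twice `I` times the Wirtinger derivative `∂u/∂z̄`. -/
def dbar (u : ℂ → ℂ) (z : ℂ) : ℂ := I * fderiv ℝ u z 1 - fderiv ℝ u z I

theorem dbar_eq_zero {u : ℂ → ℂ} {z : ℂ} (h : DifferentiableAt ℂ u z) : dbar u z = 0 := by
  have h1 := (h.hasDerivAt.hasFDerivAt.restrictScalars ℝ).fderiv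
  simp [dbar, h1]

theorem continuous_dbar {u : ℂ → ℂ} (h : ContDiff ℝ 1 u) : Continuous (dbar u) := by
  have := h.continuous_fderiv one_ne_zero
  unfold dbar
  fun_prop

theorem dbar_eventuallyEq {u v : ℂ → ℂ} {z : ℂ} (h : u =ᶠ[𝓝 z] v) : dbar u z = dbar v z := by
  simp [dbar, h.fderiv_eq]

theorem dbar_eq_zero_of_notMem_tsupport {u : ℂ → ℂ} {z : ℂ} (h : z ∉ tsupport u) :
    dbar u z = 0 := by
  have : u =ᶠ[𝓝 z] fun _ => 0 := notMem_tsupport_iff_eventuallyEq.1 h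
  rw [dbar_eventuallyEq this]
  simp [dbar]

theorem dbar_mul_holomorphic {u v : ℂ → ℂ} {z : ℂ} (hu : DifferentiableAt ℝ u z)
    (hv : DifferentiableAt ℂ v z) : dbar (fun z => u z * v z) z = dbar u z * v z := by
  have h1 := hv.hasDerivAt.hasFDerivAt.restrictScalars ℝ
  have h2 := (hu.hasFDerivAt.mul h1).fderiv
  unfold dbar
  rw [show (fun z => u z * v z) = u * v from rfl, h2]
  simp
  ring

/-- The contour integral of `a / z` around a square: at equal parameter the four integrands add up
to a multiple of `1 / (x² + S²)`, whose primitive is an arctangent. -/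
theorem integral_boundary_inv {S : ℝ} (hS : 0 < S) (a : ℂ) :
    (∫ x : ℝ in -S..S, a * ((x : ℂ) + (-S : ℝ) * I)⁻¹)
      - (∫ x : ℝ in -S..S, a * ((x : ℂ) + (S : ℝ) * I)⁻¹) +
      I • (∫ y : ℝ in -S..S, a * ((S : ℝ) + (y : ℂ) * I)⁻¹) -
      I • (∫ y : ℝ in -S..S, a * ((-S : ℝ) + (y : ℂ) * I)⁻¹) = 2 * Real.pi * I * a := by
  have hne1 : ∀ x : ℝ, (x : ℂ) + (-S : ℝ) * I ≠ 0 := fun x h => by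
    have := congrArg Complex.im h; simp at this; exact hS.ne' this
  have hne2 : ∀ x : ℝ, (x : ℂ) + (S : ℝ) * I ≠ 0 := fun x h => by
    have := congrArg Complex.im h; simp at this; exact hS.ne' this
  have hne3 : ∀ x : ℝ, ((S : ℝ) : ℂ) + (x : ℂ) * I ≠ 0 := fun x h => by
    have := congrArg Complex.re h; simp at this; exact hS.ne' this
  have hne4 : ∀ x : ℝ, ((-S : ℝ) : ℂ) + (x : ℂ) * I ≠ 0 := fun x h => by
    have := congrArg Complex.re h; simp at this; exact hS.ne' this
  have i1 : IntervalIntegrable (fun x : ℝ => a * ((x : ℂ) + (-S : ℝ) * I)⁻¹) volume (-S) S :=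
    (continuous_const.mul (Continuous.inv₀ (by fun_prop) hne1)).intervalIntegrable _ _
  have i2 : IntervalIntegrable (fun x : ℝ => a * ((x : ℂ) + (S : ℝ) * I)⁻¹) volume (-S) S :=
    (continuous_const.mul (Continuous.inv₀ (by fun_prop) hne2)).intervalIntegrable _ _
  have i3 : IntervalIntegrable (fun x : ℝ => I • (a * (((S : ℝ) : ℂ) + (x : ℂ) * I)⁻¹))
      volume (-S) S :=
    (((continuous_const.mul (Continuous.inv₀ (by fun_prop) hne3))).const_smul I).intervalIntegrable
      _ _
  have i4 : IntervalIntegrable (fun x : ℝ => I • (a * (((-S : ℝ) : ℂ) + (x : ℂ) * I)⁻¹))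
      volume (-S) S :=
    (((continuous_const.mul (Continuous.inv₀ (by fun_prop) hne4))).const_smul I).intervalIntegrable
      _ _
  rw [← intervalIntegral.integral_smul, ← intervalIntegral.integral_smul,
    ← intervalIntegral.integral_sub i1 i2, ← intervalIntegral.integral_add (i1.sub i2) i3,
    ← intervalIntegral.integral_sub ((i1.sub i2).add i3) i4]
  have key : ∀ x : ℝ, a * ((x : ℂ) + (-S : ℝ) * I)⁻¹ - a * ((x : ℂ) + (S : ℝ) * I)⁻¹
      + I • (a * (((S : ℝ) : ℂ) + (x : ℂ) * I)⁻¹) - I • (a * (((-S : ℝ) : ℂ) + (x : ℂ) * I)⁻¹)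
      = (4 * I * a * S) * ((x ^ 2 + S ^ 2 : ℝ)⁻¹ : ℝ) := by
    intro x
    have e1 := hne1 x
    have e2 := hne2 x
    have e3 := hne3 x
    have e4 := hne4 x
    have h0 : ((x : ℂ) ^ 2 + (S : ℂ) ^ 2) ≠ 0 := by
      have : (x ^ 2 + S ^ 2 : ℝ) ≠ 0 := by positivity
      exact_mod_cast this
    have f1 : ((x : ℂ) + (-S : ℝ) * I)⁻¹ = (x + S * I) / (x ^ 2 + S ^ 2) := by
      rw [inv_eq_one_div, div_eq_div_iff e1 h0]
      push_cast; ring_nf; simp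
    have f2 : ((x : ℂ) + (S : ℝ) * I)⁻¹ = (x - S * I) / (x ^ 2 + S ^ 2) := by
      rw [inv_eq_one_div, div_eq_div_iff e2 h0]
      ring_nf; simp
    have f3 : (((S : ℝ) : ℂ) + (x : ℂ) * I)⁻¹ = (S - x * I) / (x ^ 2 + S ^ 2) := by
      rw [inv_eq_one_div, div_eq_div_iff e3 h0]
      ring_nf; simp
    have f4 : (((-S : ℝ) : ℂ) + (x : ℂ) * I)⁻¹ = (-S - x * I) / (x ^ 2 + S ^ 2) := by
      rw [inv_eq_one_div, div_eq_div_iff e4 h0]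
      push_cast; ring_nf; simp
    rw [f1, f2, f3, f4]
    push_cast
    rw [smul_eq_mul, smul_eq_mul]
    field_simp
    ring
  simp_rw [key]
  rw [intervalIntegral.integral_const_mul, intervalIntegral.integral_ofReal]
  have : (∫ x : ℝ in -S..S, (x ^ 2 + S ^ 2)⁻¹) = S⁻¹ * (Real.pi / 2) := by
    have := integral_inv_sq_add_sq (a := -S) (b := S) hS.ne'
    simp_rw [add_comm _ (S ^ 2)]
    rw [this, neg_div, div_self hS.ne', Real.arctan_neg, Real.arctan_one]
    ring
  rw [this]
  have : (S : ℂ) ≠ 0 := by exact_mod_cast hS.ne'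
  push_cast
  field_simp
  ring

theorem integral_eq_iterated {D : ℂ → ℂ} (hD : Continuous D) {S : ℝ}
    (hDS : ∀ z, S ≤ ‖z‖ → D z = 0) :
    ∫ x : ℝ in -S..S, ∫ y : ℝ in -S..S, D (x + y * I) = ∫ z, D z := by
  have hc : HasCompactSupport D :=
    HasCompactSupport.intro (isCompact_closedBall (0 : ℂ) S) fun z hz =>
      hDS z (by simpa using hz : S < ‖z‖).le
  have hi : Integrable D := hD.integrable_of_hasCompactSupport hc
  have h1 : ∫ z, D z = ∫ p : ℝ × ℝ, D (p.1 + p.2 * I) := by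
    rw [← (Complex.volume_preserving_equiv_real_prod.symm).integral_comp
      (MeasurableEquiv.measurableEmbedding _)]
    congr 1
    ext p
    congr 1
    exact mk_eq_add_mul_I p.1 p.2
  have hi2 : Integrable (fun p : ℝ × ℝ => D (p.1 + p.2 * I)) := by
    have := ((Complex.volume_preserving_equiv_real_prod.symm).integrable_comp_emb
      (MeasurableEquiv.measurableEmbedding _) (g := D)).2 hi
    refine this.congr (ae_of_all _ fun p => ?_)
    simp only [Function.comp]
    congr 1
    exact mk_eq_add_mul_I p.1 p.2
  rw [h1, Measure.volume_eq_prod, integral_prod _ hi2]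
  have hin : ∀ x : ℝ, ∫ y : ℝ in -S..S, D (x + y * I) = ∫ y : ℝ, D (x + y * I) := fun x => by
    apply intervalIntegral.integral_eq_integral_of_support_subset
    intro y hy
    by_contra hy'
    refine hy (hDS _ ?_)
    have h2 : S ≤ |y| := by
      by_contra! h3
      exact hy' ⟨(abs_lt.1 h3).1, (abs_lt.1 h3).2.le⟩
    have := abs_im_le_norm ((x : ℂ) + y * I)
    simp at this
    linarith
  simp_rw [hin]
  apply intervalIntegral.integral_eq_integral_of_support_subset
  intro x hx
  by_contra hx'
  refine hx ?_
  have h2 : S ≤ |x| := by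
    by_contra! h3
    exact hx' ⟨(abs_lt.1 h3).1, (abs_lt.1 h3).2.le⟩
  have : ∀ y : ℝ, D (x + y * I) = 0 := fun y => hDS _ <| by
    have := abs_re_le_norm ((x : ℂ) + y * I)
    simp at this
    linarith
  simp [this]

/-- The numerator vanishes near `w`, so the quotient is identically `0` there, including at `w`
itself, where division by zero gives `0`. -/
theorem continuous_dbar_div {u : ℂ → ℂ} (hu : ContDiff ℝ 1 u) {w : ℂ}
    (hw : ∀ᶠ z in 𝓝 w, DifferentiableAt ℂ u z) : Continuous fun z => dbar u z / (z - w) := by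
  rw [continuous_iff_continuousAt]
  intro z
  by_cases hz : z = w
  · subst hz
    have : (fun y => dbar u y / (y - z)) =ᶠ[𝓝 z] fun _ => 0 := by
      filter_upwards [hw] with y hy
      simp [dbar_eq_zero hy]
    exact (continuousAt_const (y := (0 : ℂ))).congr_of_eventuallyEq this
  · exact (continuous_dbar hu).continuousAt.div (by fun_prop) (sub_ne_zero.2 hz)

/-- The Cauchy–Pompeiu formula at the origin, for a compactly supported function that is
holomorphic near the origin. -/
theorem integral_dbar_div_zero {u : ℂ → ℂ} (hu : ContDiff ℝ 1 u) (hc : HasCompactSupport u)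
    (h0 : ∀ᶠ z in 𝓝 (0 : ℂ), DifferentiableAt ℂ u z) :
    ∫ z, dbar u z / (z - 0) = -(2 * Real.pi * I) * u 0 := by
  obtain ⟨S, hS, hsub⟩ : ∃ S : ℝ, 0 < S ∧ tsupport u ⊆ Metric.ball 0 S := by
    obtain ⟨S, hS⟩ := hc.isBounded.subset_ball (0 : ℂ)
    exact ⟨max S 1, by positivity, hS.trans (Metric.ball_subset_ball (le_max_left _ _))⟩
  have hz0 : ∀ z : ℂ, S ≤ ‖z‖ → z ∉ tsupport u := fun z hz hz' => by
    have := hsub hz'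
    simp at this
    linarith
  -- Subtracting `u 0` removes the singularity of `u z / z`, so Green's formula applies on the whole
  -- square with no puncture. On its boundary `u` vanishes and `G` is `-u 0 / z`.
  set G : ℂ → ℂ := dslope u 0 with hG
  have hGd : Differentiable ℝ G := by
    intro z
    by_cases hz : z = 0
    · subst hz
      have := (differentiableOn_dslope (c := (0 : ℂ)) h0).2
        (fun z hz => DifferentiableAt.differentiableWithinAt hz)
      exact (this.differentiableAt h0).restrictScalars ℝ
    · have : G =ᶠ[𝓝 z] fun z => (z - 0)⁻¹ • (u z - u 0) := by
        filter_upwards [isOpen_ne.mem_nhds hz] with y hy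
        rw [hG, dslope_of_ne _ hy, slope_def_module]
      refine DifferentiableAt.congr_of_eventuallyEq ?_ this
      have h1 := (hu.differentiable one_ne_zero) z
      have h2 : DifferentiableAt ℝ (fun z : ℂ => (z - 0)⁻¹) z :=
        DifferentiableAt.restrictScalars ℝ
          (DifferentiableAt.inv (𝕜 := ℂ) (by fun_prop) (by simpa using hz))
      exact h2.smul (h1.sub_const _)
  have hGdbar : ∀ z, dbar G z = dbar u z / (z - 0) := by
    intro z
    by_cases hz : z = 0
    · subst hz
      have := (differentiableOn_dslope (c := (0 : ℂ)) h0).2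
        (fun z hz => DifferentiableAt.differentiableWithinAt hz)
      rw [dbar_eq_zero (this.differentiableAt h0)]
      simp
    · have : G =ᶠ[𝓝 z] fun z => (u z - u 0) * (z - 0)⁻¹ := by
        filter_upwards [isOpen_ne.mem_nhds hz] with y hy
        rw [hG, dslope_of_ne _ hy, slope_def_module, smul_eq_mul, mul_comm]
      have h1 := (hu.differentiable one_ne_zero) z
      have h2 : DifferentiableAt ℂ (fun z : ℂ => (z - 0)⁻¹) z :=
        DifferentiableAt.inv (by fun_prop) (by simpa using hz)
      rw [dbar_eventuallyEq this, dbar_mul_holomorphic (h1.sub_const _) h2, div_eq_mul_inv]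
      simp only [dbar, fderiv_sub_const (f := u)]
  have hcont := continuous_dbar_div hu h0
  have hrect := integral_boundary_rect_of_differentiableOn_real G
    ((-S : ℝ) + (-S : ℝ) * I) ((S : ℝ) + (S : ℝ) * I) hGd.differentiableOn (by
      have : (fun z => I • fderiv ℝ G z 1 - fderiv ℝ G z I) = fun z => dbar u z / (z - 0) := by
        ext z
        rw [← hGdbar]
        rfl
      rw [this]
      refine hcont.continuousOn.integrableOn_compact ?_
      exact isCompact_uIcc.reProdIm isCompact_uIcc)
  have hbd : ∀ z : ℂ, S ≤ ‖z‖ → G z = -u 0 * z⁻¹ := by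
    intro z hz
    have hzne : z ≠ 0 := by
      rintro rfl
      simp at hz
      linarith
    rw [hG, dslope_of_ne _ hzne, slope_def_module, image_eq_zero_of_notMem_tsupport (hz0 z hz)]
    simp
    ring
  have hre : ∀ x y : ℝ, S ≤ |x| ∨ S ≤ |y| → G ((x : ℂ) + y * I) = -u 0 * ((x : ℂ) + y * I)⁻¹ := by
    intro x y hxy
    refine hbd _ ?_
    have h1 := abs_re_le_norm ((x : ℂ) + y * I)
    have h2 := abs_im_le_norm ((x : ℂ) + y * I)
    simp at h1 h2
    rcases hxy with h | h <;> linarith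
  have hSa : |S| = S := abs_of_pos hS
  simp only [add_re, ofReal_re, mul_re, I_re, mul_zero, ofReal_im, I_im, mul_one, sub_self,
    add_zero, add_im, mul_im, zero_add] at hrect
  have hval := integral_boundary_inv hS (-u 0)
  have e1 : ∀ x : ℝ, G (x + (-S : ℝ) * I) = -u 0 * ((x : ℂ) + (-S : ℝ) * I)⁻¹ :=
    fun x => hre x (-S) (Or.inr (by rw [abs_neg, hSa]))
  have e2 : ∀ x : ℝ, G (x + (S : ℝ) * I) = -u 0 * ((x : ℂ) + (S : ℝ) * I)⁻¹ :=
    fun x => hre x S (Or.inr (by rw [hSa]))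
  have e3 : ∀ x : ℝ, G ((S : ℝ) + x * I) = -u 0 * (((S : ℝ) : ℂ) + x * I)⁻¹ :=
    fun x => hre S x (Or.inl (by rw [hSa]))
  have e4 : ∀ x : ℝ, G ((-S : ℝ) + x * I) = -u 0 * (((-S : ℝ) : ℂ) + x * I)⁻¹ :=
    fun x => hre (-S) x (Or.inl (by rw [abs_neg, hSa]))
  simp_rw [e1, e2, e3, e4] at hrect
  rw [hval] at hrect
  have hD : ∀ z, I • fderiv ℝ G z 1 - fderiv ℝ G z I = dbar u z / (z - 0) := fun z => by
    rw [← hGdbar]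
    rfl
  simp_rw [hD] at hrect
  rw [integral_eq_iterated hcont (S := S) fun z hz => by
    rw [dbar_eq_zero_of_notMem_tsupport (hz0 z hz), zero_div]] at hrect
  rw [← hrect]
  ring

/-- The Cauchy–Pompeiu formula for a compactly supported function, at a point near which the
function is holomorphic. -/
theorem integral_dbar_div {u : ℂ → ℂ} (hu : ContDiff ℝ 1 u) (hc : HasCompactSupport u) {w : ℂ}
    (hw : ∀ᶠ z in 𝓝 w, DifferentiableAt ℂ u z) :
    ∫ z, dbar u z / (z - w) = -(2 * Real.pi * I) * u w := by
  have h := integral_dbar_div_zero (u := fun z => u (z + w)) (by fun_prop)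
    (hc.comp_homeomorph (Homeomorph.addRight w)) (by
      have : Tendsto (fun z : ℂ => z + w) (𝓝 0) (𝓝 w) := by
        have : ContinuousAt (fun z : ℂ => z + w) 0 := by fun_prop
        simpa [ContinuousAt] using this
      filter_upwards [this.eventually hw] with z hz
      exact differentiableAt_comp_add_const.2 hz)
  rw [zero_add] at h
  rw [← h, ← integral_add_right_eq_self (fun z => dbar u z / (z - w)) w]
  congr 1
  ext z
  simp [dbar, fderiv_comp_add_right]
end

/-! ### Runge's theorem for closed function algebras -/

noncomputable section

open Complex MeasureTheory

theorem exists_contDiff_eq_one_near {X O : Set ℂ} (hX : IsCompact X) (hO : IsOpen O)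
    (hXO : X ⊆ O) : ∃ χ : ℂ → ℂ, ContDiff ℝ 1 χ ∧ HasCompactSupport χ ∧ tsupport χ ⊆ O ∧
      ∀ᶠ z in 𝓝ˢ X, χ z = 1 := by
  obtain ⟨K, hK, hXK, hKO⟩ := exists_compact_between hX hO hXO
  obtain ⟨f, hf1, hf0, -⟩ := exists_contMDiffMap_one_nhds_of_subset_interior
    (modelWithCornersSelf ℝ ℂ) (n := 1) hX.isClosed hXK
  have hsub : tsupport (fun z => ((f z : ℝ) : ℂ)) ⊆ K := by
    refine closure_minimal (fun z hz => ?_) hK.isClosed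
    by_contra h
    exact hz (by simp [hf0 z h])
  refine ⟨fun z => ((f z : ℝ) : ℂ), ?_, HasCompactSupport.of_support_subset_isCompact hK
    (subset_closure.trans hsub), hsub.trans hKO, ?_⟩
  · exact ofRealCLM.contDiff.comp f.contMDiff.contDiff
  · filter_upwards [hf1] with z hz
    simp [hz]

/-- The algebra `A` of functions on `X` contains the function `w ↦ (z - w)⁻¹`. -/
def KernelMem {X : Set ℂ} (A : Subalgebra ℂ C(X, ℂ)) (z : ℂ) : Prop :=
  ∃ φ ∈ A, ∀ w : X, φ w * (z - w) = 1

/-- **Runge's theorem**: a closed algebra of functions on a compact set `X` that contains all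
Cauchy kernels with pole off `X` contains every function holomorphic in a neighbourhood of `X`. -/
theorem exists_mem_eq_of_kernelMem {X : Set ℂ} (hX : IsCompact X) {A : Subalgebra ℂ C(X, ℂ)}
    (hA : IsClosed (A : Set C(X, ℂ))) (hker : ∀ z ∉ X, KernelMem A z) {O : Set ℂ}
    (hO : IsOpen O) (hXO : X ⊆ O) {F : ℂ → ℂ} (hF : DifferentiableOn ℂ F O) :
    ∃ φ ∈ A, ∀ w : X, φ w = F w := by
  have : CompactSpace X := isCompact_iff_compactSpace.1 hX
  obtain ⟨χ, hχ, hχc, hχO, hχ1⟩ := exists_contDiff_eq_one_near hX hO hXO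
  set u : ℂ → ℂ := fun z => χ z * F z with hu
  have hFO : ContDiffOn ℂ 1 F O := hF.contDiffOn hO
  have huc : ContDiff ℝ 1 u := by
    rw [contDiff_iff_contDiffAt]
    intro z
    by_cases hz : z ∈ tsupport χ
    · have h1 : ContDiffAt ℂ 1 F z := hFO.contDiffAt (hO.mem_nhds (hχO hz))
      exact hχ.contDiffAt.mul (h1.restrict_scalars ℝ)
    · have : u =ᶠ[𝓝 z] fun _ => 0 := by
        filter_upwards [notMem_tsupport_iff_eventuallyEq.1 hz] with y hy
        simp [hu, hy]
      exact contDiffAt_const.congr_of_eventuallyEq this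
  have husupp : HasCompactSupport u := hχc.mul_right
  have hnear : ∀ w ∈ X, ∀ᶠ z in 𝓝 w, DifferentiableAt ℂ u z := by
    intro w hw
    have h1 : ∀ᶠ z in 𝓝 w, χ z = 1 := mem_nhdsSet_iff_forall.1 hχ1 w hw
    filter_upwards [eventually_eventually_nhds.2 h1, hO.mem_nhds (hXO hw)] with z hz hzO
    refine (hF.differentiableAt (hO.mem_nhds hzO)).congr_of_eventuallyEq ?_
    filter_upwards [hz] with y hy
    simp [hu, hy]
  have hval : ∀ w ∈ X, u w = F w := fun w hw => by
    have : χ w = 1 := hχ1.self_of_nhdsSet w hw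
    simp [hu, this]
  have hjoint : Continuous fun p : ℂ × X => dbar u p.1 / (p.1 - p.2) := by
    rw [continuous_iff_continuousAt]
    rintro ⟨z, w⟩
    by_cases hz : z ∈ X
    · have : (fun p : ℂ × X => dbar u p.1 / (p.1 - p.2)) =ᶠ[𝓝 (z, w)] fun _ => 0 := by
        filter_upwards [continuousAt_fst.eventually (hnear z hz)] with p hp
        rw [dbar_eq_zero hp, zero_div]
      exact continuousAt_const.congr_of_eventuallyEq this
    · have := continuous_dbar huc
      refine ContinuousAt.div (by fun_prop) (by fun_prop) (sub_ne_zero.2 ?_)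
      exact fun h : z = w => hz (h ▸ w.2)
  -- Cauchy–Pompeiu for `u`, read as a `C(X, ℂ)`-valued Bochner integral. Each value is zero or a
  -- multiple of a kernel in `A`, so the integral stays in the closed subspace `A`.
  set Φ : C(ℂ, C(X, ℂ)) := ContinuousMap.curry ⟨_, hjoint⟩ with hΦ
  have hΦv : ∀ z w, Φ z w = dbar u z / (z - w) := fun z w => rfl
  have hΦA : ∀ z, Φ z ∈ A := by
    intro z
    by_cases hz : z ∈ X
    · have : Φ z = 0 := by
        ext w
        rw [hΦv, dbar_eq_zero (hnear z hz).self_of_nhds, zero_div]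
        rfl
      rw [this]
      exact A.zero_mem
    · obtain ⟨φ, hφA, hφ⟩ := hker z hz
      have : Φ z = dbar u z • φ := by
        ext w
        have hzw : z - w ≠ 0 := sub_ne_zero.2 fun h => hz (h ▸ w.2)
        rw [hΦv, ContinuousMap.smul_apply, smul_eq_mul, div_eq_iff hzw, mul_assoc, hφ, mul_one]
      rw [this]
      exact A.smul_mem hφA _
  have hΦs : HasCompactSupport Φ := by
    refine HasCompactSupport.intro husupp fun z hz => ?_
    ext w
    rw [hΦv, dbar_eq_zero_of_notMem_tsupport hz, zero_div]
    rfl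
  have hΦi : Integrable Φ := Φ.continuous.integrable_of_hasCompactSupport hΦs
  let B : Submodule ℝ C(X, ℂ) := (Subalgebra.toSubmodule A).restrictScalars ℝ
  have : CompleteSpace B :=
    (show IsClosed (B : Set C(X, ℂ)) from hA).isComplete.completeSpace_coe
  have hint : ∫ z, Φ z ∈ A := by
    have h := B.subtypeL.integral_comp_comm (μ := volume) (φ := fun z => (⟨Φ z, hΦA z⟩ : B)) (by
      refine Continuous.integrable_of_hasCompactSupport (by fun_prop) ?_
      refine HasCompactSupport.intro hΦs fun z hz => ?_
      exact Subtype.ext (image_eq_zero_of_notMem_tsupport (f := ⇑Φ) hz))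
    have h' : ∫ z, Φ z = B.subtypeL (∫ z, (⟨Φ z, hΦA z⟩ : B)) := h
    rw [h']
    exact (∫ z, (⟨Φ z, hΦA z⟩ : B)).2
  refine ⟨(-(2 * Real.pi * I))⁻¹ • ∫ z, Φ z, A.smul_mem hint _, fun w => ?_⟩
  have heval := (ContinuousMap.evalCLM ℂ w).integral_comp_comm hΦi
  have heval' : (∫ z, Φ z) w = ∫ z, dbar u z / (z - w) := heval.symm
  rw [ContinuousMap.smul_apply, heval', integral_dbar_div huc husupp (hnear w w.2), hval w w.2,
    smul_eq_mul, inv_mul_cancel_left₀ (neg_ne_zero.2 two_pi_I_ne_zero)]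

/-- Neumann series in the Banach algebra `A`; compactness makes the sup norm of `φ` strictly less
than `1`. -/
theorem isUnit_one_sub_mem {X : Set ℂ} [CompactSpace X] {A : Subalgebra ℂ C(X, ℂ)}
    (hA : IsClosed (A : Set C(X, ℂ))) {φ : C(X, ℂ)} (hφ : φ ∈ A) (hn : ∀ w, ‖φ w‖ < 1) :
    ∃ ψ ∈ A, ∀ w, ψ w * (1 - φ w) = 1 := by
  have : CompleteSpace A := hA.isComplete.completeSpace_coe
  have hlt : ‖(⟨φ, hφ⟩ : A)‖ < 1 := (ContinuousMap.norm_lt_iff φ one_pos).2 hn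
  refine ⟨((Units.oneSub (⟨φ, hφ⟩ : A) hlt)⁻¹ : Aˣ).1, Subtype.prop _, fun w => ?_⟩
  have := (Units.oneSub (⟨φ, hφ⟩ : A) hlt).inv_mul
  exact congrArg (fun a : A => (a : C(X, ℂ)) w) this

/-- Pole shifting: `(z' - w)⁻¹ = (z - w)⁻¹ (1 - (z - z') / (z - w))⁻¹`, and the last factor is a
Neumann series in `A`. -/
theorem KernelMem.spread {X : Set ℂ} (hX : IsCompact X) {A : Subalgebra ℂ C(X, ℂ)}
    (hA : IsClosed (A : Set C(X, ℂ))) {z z' : ℂ} (h : KernelMem A z)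
    (hz : ∀ w ∈ X, ‖z' - z‖ < ‖z - w‖) : KernelMem A z' := by
  have : CompactSpace X := isCompact_iff_compactSpace.1 hX
  obtain ⟨φ, hφA, hφ⟩ := h
  have hne : ∀ w : X, z - w ≠ 0 := fun w h => by simpa [h] using hφ w
  have hφ' : ∀ w : X, φ w = (z - w)⁻¹ := fun w => eq_inv_of_mul_eq_one_left (hφ w)
  obtain ⟨ψ, hψA, hψ⟩ := isUnit_one_sub_mem hA (A.smul_mem hφA (z - z')) fun w => by
    rw [ContinuousMap.smul_apply, smul_eq_mul, hφ', norm_mul, norm_inv, ← div_eq_mul_inv,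
      div_lt_one (norm_pos_iff.2 (hne w)), norm_sub_rev]
    exact hz w w.2
  refine ⟨ψ * φ, A.mul_mem hψA hφA, fun w => ?_⟩
  have := hψ w
  rw [ContinuousMap.smul_apply, smul_eq_mul, hφ'] at this
  rw [ContinuousMap.mul_apply, hφ', ← this]
  have := hne w
  field_simp
  ring

theorem kernelMem_of_norm_lt {X : Set ℂ} (hX : IsCompact X) {A : Subalgebra ℂ C(X, ℂ)}
    (hA : IsClosed (A : Set C(X, ℂ)))
    (hid : (⟨fun w => w, continuous_subtype_val⟩ : C(X, ℂ)) ∈ A) {z : ℂ}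
    (hz : ∀ w ∈ X, ‖w‖ < ‖z‖) (hz0 : z ≠ 0) : KernelMem A z := by
  have : CompactSpace X := isCompact_iff_compactSpace.1 hX
  obtain ⟨ψ, hψA, hψ⟩ := isUnit_one_sub_mem hA (A.smul_mem hid z⁻¹) fun w => by
    rw [ContinuousMap.smul_apply, smul_eq_mul, norm_mul, norm_inv, mul_comm, ← div_eq_mul_inv,
      div_lt_one (norm_pos_iff.2 hz0)]
    exact hz w w.2
  refine ⟨z⁻¹ • ψ, A.smul_mem hψA _, fun w => ?_⟩
  have h : ψ w * (1 - z⁻¹ * w) = 1 := hψ w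
  rw [ContinuousMap.smul_apply, smul_eq_mul, ← h]
  field_simp

/-! ### Continuous logarithms on plane sets -/

/-- The function `φ` has a continuous logarithm on `X`. -/
def HasLogOn (X : Set ℂ) (φ : ℂ → ℂ) : Prop :=
  ∃ l : ℂ → ℂ, ContinuousOn l X ∧ ∀ w ∈ X, exp (l w) = φ w

theorem HasLogOn.ne_zero {X : Set ℂ} {φ : ℂ → ℂ} (h : HasLogOn X φ) {w : ℂ} (hw : w ∈ X) :
    φ w ≠ 0 := by
  obtain ⟨l, -, hl⟩ := h
  exact hl w hw ▸ exp_ne_zero _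

theorem HasLogOn.mul {X : Set ℂ} {φ ψ : ℂ → ℂ} (hφ : HasLogOn X φ) (hψ : HasLogOn X ψ) :
    HasLogOn X fun w => φ w * ψ w := by
  obtain ⟨l, hl, hl'⟩ := hφ
  obtain ⟨m, hm, hm'⟩ := hψ
  exact ⟨fun w => l w + m w, hl.add hm, fun w hw => by simp [exp_add, hl' w hw, hm' w hw]⟩

theorem HasLogOn.div {X : Set ℂ} {φ ψ : ℂ → ℂ} (hφ : HasLogOn X φ) (hψ : HasLogOn X ψ) :
    HasLogOn X fun w => φ w / ψ w := by
  obtain ⟨l, hl, hl'⟩ := hφ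
  obtain ⟨m, hm, hm'⟩ := hψ
  exact ⟨fun w => l w - m w, hl.sub hm, fun w hw => by simp [exp_sub, hl' w hw, hm' w hw]⟩

theorem HasLogOn.congr {X : Set ℂ} {φ ψ : ℂ → ℂ} (hφ : HasLogOn X φ) (h : ∀ w ∈ X, φ w = ψ w) :
    HasLogOn X ψ := by
  obtain ⟨l, hl, hl'⟩ := hφ
  exact ⟨l, hl, fun w hw => (hl' w hw).trans (h w hw)⟩

theorem HasLogOn.union {X Y : Set ℂ} {φ : ℂ → ℂ} (hX : IsClosed X) (hY : IsClosed Y)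
    (hd : Disjoint X Y) (h1 : HasLogOn X φ) (h2 : HasLogOn Y φ) : HasLogOn (X ∪ Y) φ := by
  classical
  obtain ⟨l, hl, hl'⟩ := h1
  obtain ⟨m, hm, hm'⟩ := h2
  have e1 : EqOn (X.piecewise l m) l X := X.piecewise_eqOn l m
  have e2 : EqOn (X.piecewise l m) m Y :=
    (X.piecewise_eqOn_compl l m).mono hd.symm.subset_compl_right
  refine ⟨X.piecewise l m, (hl.congr e1).union_of_isClosed (hm.congr e2) hX hY, fun w hw => ?_⟩
  rcases hw with hw | hw
  · rw [e1 hw, hl' w hw]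
  · rw [e2 hw, hm' w hw]

theorem hasLogOn_of_norm_sub_one_lt {X : Set ℂ} {φ : ℂ → ℂ} (hc : ContinuousOn φ X)
    (hφ : ∀ w ∈ X, ‖φ w - 1‖ < 1) : HasLogOn X φ := by
  have hs : ∀ w ∈ X, φ w ∈ slitPlane := fun w hw => by
    simpa using mem_slitPlane_of_norm_lt_one (hφ w hw)
  exact ⟨fun w => log (φ w), hc.clog hs, fun w hw => exp_log (slitPlane_ne_zero (hs w hw))⟩

theorem hasLogOn_const {X : Set ℂ} {c : ℂ} (hc : c ≠ 0) : HasLogOn X fun _ => c :=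
  ⟨fun _ => log c, continuousOn_const, fun _ _ => exp_log hc⟩

theorem hasLogOn_sub_div_sub {X : Set ℂ} {z z' : ℂ} (hz : ∀ w ∈ X, ‖z' - z‖ < ‖z - w‖) :
    HasLogOn X fun w => (w - z') / (w - z) := by
  have hne : ∀ w ∈ X, w - z ≠ 0 := fun w hw h => by
    have := hz w hw
    rw [← neg_sub w, h, neg_zero, norm_zero] at this
    exact (norm_nonneg _).not_gt this
  refine hasLogOn_of_norm_sub_one_lt
    (ContinuousOn.div (by fun_prop) (by fun_prop) hne) fun w hw => ?_
  rw [div_sub_one (hne w hw), norm_div, div_lt_one (norm_pos_iff.2 (hne w hw))]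
  have := hz w hw
  rwa [← norm_sub_rev z, sub_sub_sub_cancel_left, ← norm_sub_rev z']

/-- Same hypothesis on the two points as in `KernelMem.spread`, so one topological argument serves
both properties. -/
theorem HasLogOn.spread {X : Set ℂ} {z z' : ℂ} (h : HasLogOn X fun w => w - z)
    (hz : ∀ w ∈ X, ‖z' - z‖ < ‖z - w‖) : HasLogOn X fun w => w - z' := by
  refine (h.mul (hasLogOn_sub_div_sub hz)).congr fun w hw => ?_
  have : w - z ≠ 0 := h.ne_zero hw
  field_simp

theorem hasLogOn_sub_of_norm_lt {X : Set ℂ} {z : ℂ} (hz : ∀ w ∈ X, ‖w‖ < ‖z‖) (hz0 : z ≠ 0) :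
    HasLogOn X fun w => w - z := by
  refine ((hasLogOn_const (neg_ne_zero.2 hz0)).mul (hasLogOn_of_norm_sub_one_lt
    (φ := fun w => 1 - w / z) (by fun_prop) fun w hw => ?_)).congr fun w _ => ?_
  · rw [sub_sub_cancel_left, norm_neg, norm_div, div_lt_one (norm_pos_iff.2 hz0)]
    exact hz w hw
  · field_simp
    ring
end

/-! ### Locally constant properties of poles, and winding -/

noncomputable section

open Complex

/-- A property that spreads is locally constant off `X`: within half the distance from `z` to `X`,
it spreads both from `z` to `z'` and back. -/
theorem eventually_iff_of_spread {X : Set ℂ} (hX : IsClosed X) {P : ℂ → Prop}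
    (hP : ∀ z z', P z → (∀ w ∈ X, ‖z' - z‖ < ‖z - w‖) → P z') {z : ℂ} (hz : z ∉ X) :
    ∀ᶠ z' in 𝓝 z, z' ∉ X ∧ (P z' ↔ P z) := by
  obtain ⟨ε, hε, hb⟩ := Metric.isOpen_iff.1 hX.isOpen_compl z hz
  have hle : ∀ w ∈ X, ε ≤ ‖z - w‖ := fun w hw => by
    by_contra! h
    refine hb (?_ : w ∈ Metric.ball z ε) hw
    rwa [Metric.mem_ball, dist_comm, dist_eq_norm]
  filter_upwards [Metric.ball_mem_nhds z (half_pos hε)] with z' hz'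
  rw [Metric.mem_ball, dist_eq_norm] at hz'
  refine ⟨hb (Metric.mem_ball.2 (by rw [dist_eq_norm]; linarith)), fun h => hP z' z h ?_,
    fun h => hP z z' h ?_⟩
  · intro w hw
    have h1 := hle w hw
    have h2 := norm_sub_le_norm_sub_add_norm_sub z z' w
    rw [norm_sub_rev z z'] at *
    linarith
  · intro w hw
    have h1 := hle w hw
    linarith

theorem isOpen_of_spread {X : Set ℂ} (hX : IsClosed X) {P : ℂ → Prop}
    (hP : ∀ z z', P z → (∀ w ∈ X, ‖z' - z‖ < ‖z - w‖) → P z') : IsOpen {z | z ∉ X ∧ P z} :=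
  isOpen_iff_mem_nhds.2 fun _ hz => (eventually_iff_of_spread hX hP hz.1).mono
    fun _ h => ⟨h.1, h.2.2 hz.2⟩

theorem isOpen_not_of_spread {X : Set ℂ} (hX : IsClosed X) {P : ℂ → Prop}
    (hP : ∀ z z', P z → (∀ w ∈ X, ‖z' - z‖ < ‖z - w‖) → P z') : IsOpen {z | z ∉ X ∧ ¬ P z} :=
  isOpen_iff_mem_nhds.2 fun _ hz => (eventually_iff_of_spread hX hP hz.1).mono
    fun _ h => ⟨h.1, fun h' => hz.2 (h.2.1 h')⟩

/-- A nowhere vanishing continuous function on the plane cannot agree with `z ↦ z - z₀` off a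
bounded set. -/
theorem exists_eq_zero_of_eq_sub {H : ℂ → ℂ} (hH : Continuous H) {z₀ : ℂ} {R : ℝ} (hR : 0 < R)
    (hs : ∀ z, ‖z - z₀‖ = R → H z = z - z₀) : ∃ z, H z = 0 := by
  by_contra! hne
  have hsc : IsSimplyConnected (univ : Set ℂ) := by
    have : ContractibleSpace (univ : Set ℂ) :=
      (convex_univ : Convex ℝ (univ : Set ℂ)).contractibleSpace univ_nonempty
    exact (inferInstance : SimplyConnectedSpace (univ : Set ℂ))
  obtain ⟨M, hM, hexp⟩ := exists_continuousOn_eqOn_exp_comp hsc isOpen_univ hH.continuousOn (by simpa using hne)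
  rw [continuousOn_univ] at hM
  -- With `H = exp ∘ M`, this `g` is a continuous lift of the constant `R` through `exp`, hence
  -- constant; but the first term is `2π`-periodic and the second is not.
  set g : ℝ → ℂ := fun θ => M (circleMap z₀ R θ) - θ * I with hg
  have hgc : Continuous g := by
    have := continuous_circleMap z₀ R
    fun_prop
  have hge : ∀ θ, exp (g θ) = R := fun θ => by
    have h1 : exp (M (circleMap z₀ R θ)) = H (circleMap z₀ R θ) := hexp (mem_univ _)
    have h2 : H (circleMap z₀ R θ) = circleMap z₀ R θ - z₀ := hs _ (by
      simp [abs_of_pos hR])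
    rw [hg]
    simp only
    rw [exp_sub, h1, h2, circleMap_sub_center, circleMap_zero, mul_div_assoc,
      div_self (exp_ne_zero _), mul_one]
  have hconst : g = fun _ => g 0 := isCoveringMap_exp.eq_of_comp_eq hgc continuous_const
    (by ext θ; simp [hge]) 0 rfl
  have h2π := congrFun hconst (2 * Real.pi)
  have hper : circleMap z₀ R (2 * Real.pi) = circleMap z₀ R 0 := by
    have := periodic_circleMap z₀ R 0
    rwa [zero_add] at this
  simp only [hg, hper] at h2π
  have h3 : (2 * Real.pi * I : ℂ) = 0 := by
    push_cast at h2π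
    linear_combination -h2π
  exact two_pi_I_ne_zero h3

/-- The boundary of a bounded set `W ∋ z₀` carries no continuous logarithm of
`(w - z₀) / ψ w` when `ψ` does not vanish on the closure of `W`. -/
theorem not_hasLogOn_frontier {X W : Set ℂ} (hX : IsClosed X)
    (hWb : Bornology.IsBounded W) (hfr : frontier W ⊆ X) {z₀ : ℂ} (hz₀ : z₀ ∈ W) {ψ : ℂ → ℂ}
    (hψ : ContinuousOn ψ (closure W)) (hψ0 : ∀ w ∈ closure W, ψ w ≠ 0) :
    ¬ HasLogOn X fun w => (w - z₀) / ψ w := by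
  classical
  rintro ⟨l, hl, hl'⟩
  obtain ⟨Λ, hΛ⟩ := ContinuousMap.exists_restrict_eq hX
    (⟨fun w : X => l w, continuousOn_iff_continuous_domRestrict.1 hl⟩ : C(X, ℂ))
  have hΛ' : ∀ w ∈ X, Λ w = l w := fun w hw => congrArg (fun φ : C(X, ℂ) => φ ⟨w, hw⟩) hΛ
  -- With the logarithm extended by Tietze, the two formulas agree on the frontier of `W`. The glued
  -- function has no zero, since `w - z₀` vanishes only inside `W`.
  have hH : Continuous (W.piecewise (fun w => exp (Λ w) * ψ w) fun w => w - z₀) := by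
    refine continuous_piecewise (fun w hw => ?_) ?_ (by fun_prop)
    · have hwX := hfr hw
      rw [hΛ' w hwX, hl' w hwX, div_mul_cancel₀ _ (hψ0 w hw.1)]
    · exact (Λ.continuous.cexp).continuousOn.mul hψ
  obtain ⟨R, hR⟩ := hWb.subset_ball z₀
  have hR0 : 0 < R := by simpa using hR hz₀
  obtain ⟨z, hz⟩ := exists_eq_zero_of_eq_sub hH hR0 fun z hz => by
    refine piecewise_eq_of_notMem _ _ _ fun hzW => ?_
    have := hR hzW
    rw [Metric.mem_ball, dist_eq_norm] at this
    linarith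
  by_cases hzW : z ∈ W
  · rw [piecewise_eq_of_mem _ _ _ hzW] at hz
    exact mul_ne_zero (exp_ne_zero _) (hψ0 z (subset_closure hzW)) hz
  · rw [piecewise_eq_of_notMem _ _ _ hzW] at hz
    exact hzW (sub_eq_zero.1 hz ▸ hz₀)
end

/-! ### Compact cores and the absence of holes -/

noncomputable section

open Complex

/-- The points of modulus at most `R` whose distance to the complement of `Ω` is at least `ε`. -/
def core (Ω : Set ℂ) (R ε : ℝ) : Set ℂ := {z | ‖z‖ ≤ R ∧ ∀ q ∉ Ω, ε ≤ ‖z - q‖}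

theorem isCompact_core (Ω : Set ℂ) (R ε : ℝ) : IsCompact (core Ω R ε) := by
  refine (isCompact_closedBall (0 : ℂ) R).of_isClosed_subset ?_ fun z hz => by simpa using hz.1
  simp only [core, ofPred_and, ofPred_forall]
  refine (isClosed_le continuous_norm continuous_const).inter
    (isClosed_iInter fun q => isClosed_iInter fun _ => isClosed_le continuous_const (by fun_prop))

theorem core_subset {Ω : Set ℂ} {R ε : ℝ} (hε : 0 < ε) : core Ω R ε ⊆ Ω := fun z hz => by
  by_contra h
  have := hz.2 z h
  rw [sub_self, norm_zero] at this
  linarith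

/-- The reason for working with cores: a pole off the core is far out or can be traded for a nearby
point off `Ω`. -/
theorem notMem_core {Ω : Set ℂ} {R ε : ℝ} {z : ℂ} (h : z ∉ core Ω R ε) :
    R < ‖z‖ ∨ ∃ q ∉ Ω, ‖z - q‖ < ε := by
  by_contra! h'
  exact h h'

theorem exists_subset_core {Ω K : Set ℂ} (hΩ : IsOpen Ω) (hK : IsCompact K) (hKΩ : K ⊆ Ω) :
    ∃ R > 0, ∃ ε > 0, K ⊆ core Ω R ε := by
  obtain ⟨R, hR⟩ := hK.isBounded.subset_closedBall (0 : ℂ)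
  obtain ⟨ε, hε, hsub⟩ := hK.exists_thickening_subset_open hΩ hKΩ
  refine ⟨max R 1, by positivity, ε, hε, fun z hz => ⟨?_, fun q hq => ?_⟩⟩
  · have := hR hz
    rw [mem_closedBall_zero_iff] at this
    exact this.trans (le_max_left _ _)
  · by_contra! hlt
    refine hq (hsub (Metric.mem_thickening_iff.2 ⟨z, hz, ?_⟩))
    rwa [dist_comm, dist_eq_norm]

/-- A pole near `q ∉ U` inherits `P` from `q`. The component of `q` in the complement of `U`
contains `∞`, near which `P` holds, and `P` is locally constant along it. -/
theorem of_spread_of_hasNoHoles {U : Set ℂ} (hUh : HasNoHoles U) {R ε : ℝ} (hε : 0 < ε)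
    {P : ℂ → Prop}
    (hP : ∀ z z', P z → (∀ w ∈ core U R ε, ‖z' - z‖ < ‖z - w‖) → P z')
    (hR : ∀ z, R < ‖z‖ → P z) {z : ℂ} (hz : z ∉ core U R ε) : P z := by
  set L := core U R ε with hL
  have hLc : IsCompact L := isCompact_core U R ε
  rcases notMem_core hz with h | ⟨q, hqU, hzq⟩
  · exact hR z h
  have hPq : P q := by
    by_contra hnq
    set S : Set (OnePoint ℂ) := (toSphere U)ᶜ with hS
    have hqS : ((q : ℂ) : OnePoint ℂ) ∈ S := by
      rintro ⟨u, hu, huq⟩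
      exact hqU (OnePoint.coe_injective huq ▸ hu)
    have hinf : OnePoint.infty ∈ connectedComponentIn S (q : OnePoint ℂ) := by
      by_contra h
      exact hUh _ ⟨⟨_, hqS, rfl⟩, h⟩
    set B : Set ℂ := {z | z ∉ L ∧ ¬ P z} with hB
    set A : Set ℂ := {z | z ∉ L ∧ P z}ᶜ with hA
    have hBo : IsOpen B := isOpen_not_of_spread hLc.isClosed hP
    have hAc : IsClosed A := (isOpen_of_spread hLc.isClosed hP).isClosed_compl
    have hAk : IsCompact A := by
      refine (isCompact_closedBall (0 : ℂ) R).of_isClosed_subset hAc fun z hz => ?_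
      rw [mem_closedBall_zero_iff]
      by_contra! h
      exact hz ⟨fun hzL => hzL.1.not_gt h, hR z h⟩
    -- This open set consists of `∞` and the good points; together with the bad points it would
    -- disconnect the component of `q`.
    have hG1 : IsOpen ((fun z : ℂ => (z : OnePoint ℂ)) '' A)ᶜ :=
      OnePoint.isOpen_compl_image_coe.2 ⟨hAc, hAk⟩
    have hG2 : IsOpen ((fun z : ℂ => (z : OnePoint ℂ)) '' B) := OnePoint.isOpen_image_coe.2 hBo
    have hqL : q ∉ L := fun h => hqU (core_subset hε h)
    obtain ⟨x, hx, hx1, hx2⟩ := isPreconnected_connectedComponentIn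
      (F := S) (x := (q : OnePoint ℂ)) _ _ hG1 hG2 (fun x hx => by
        have hxS : x ∈ S := connectedComponentIn_subset _ _ hx
        induction x using OnePoint.rec with
        | infty => exact Or.inl (by simp)
        | coe x =>
          have hxL : x ∉ L := fun h => hxS ⟨x, core_subset hε h, rfl⟩
          by_cases hPx : P x
          · left
            rintro ⟨y, hy, hyx⟩
            exact hy (OnePoint.coe_injective hyx ▸ ⟨hxL, hPx⟩)
          · exact Or.inr ⟨x, ⟨hxL, hPx⟩, rfl⟩)
      ⟨_, hinf, by simp⟩ ⟨_, mem_connectedComponentIn hqS, q, ⟨hqL, hnq⟩, rfl⟩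
    obtain ⟨y, hy, rfl⟩ := hx2
    exact hx1 ⟨y, fun h => hy.2 h.2, rfl⟩
  exact hP q z hPq fun w hw => hzq.trans_le (norm_sub_rev w q ▸ hw.2 q hqU)

theorem hasLogOn_sub_core {U : Set ℂ} (hUh : HasNoHoles U) {R ε : ℝ} (hR : 0 < R) (hε : 0 < ε)
    {z : ℂ} (hz : z ∉ core U R ε) : HasLogOn (core U R ε) fun w => w - z :=
  of_spread_of_hasNoHoles hUh hε (P := fun z => HasLogOn (core U R ε) fun w => w - z)
    (fun _ _ h h' => h.spread h')
    (fun _ hz => hasLogOn_sub_of_norm_lt (fun _ hw => hw.1.trans_lt hz)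
      (norm_pos_iff.1 (hR.trans hz))) hz

theorem hasLogOn_polynomial_core {U : Set ℂ} (hUh : HasNoHoles U) {R ε : ℝ} (hR : 0 < R)
    (hε : 0 < ε) {p : Polynomial ℂ} (hp : p ≠ 0) (hp0 : ∀ w ∈ core U R ε, p.eval w ≠ 0) :
    HasLogOn (core U R ε) fun w => p.eval w := by
  have key : ∀ s : Multiset ℂ, (∀ a ∈ s, a ∉ core U R ε) →
      HasLogOn (core U R ε) fun w => (s.map fun a => w - a).prod := by
    intro s
    induction s using Multiset.induction with
    | empty => intro _; simpa using hasLogOn_const one_ne_zero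
    | cons a s ih =>
      intro hs
      simp only [Multiset.map_cons, Multiset.prod_cons]
      exact (hasLogOn_sub_core hUh hR hε (hs a (Multiset.mem_cons_self a s))).mul
        (ih fun b hb => hs b (Multiset.mem_cons_of_mem hb))
  refine ((hasLogOn_const (Polynomial.leadingCoeff_ne_zero.2 hp)).mul
    (key p.roots fun a ha h => hp0 a h (Polynomial.isRoot_of_mem_roots ha))).congr fun w _ => ?_
  exact ((IsAlgClosed.splits p).eval_eq_prod_roots w).symm

/-- Runge for the closure of the polynomials: kernels with far poles come from a Neumann series, and
the absence of holes carries them to every pole off the core. -/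
theorem exists_polynomial_near {U : Set ℂ} (hUo : IsOpen U) (hUh : HasNoHoles U) {R ε : ℝ}
    (hR : 0 < R) (hε : 0 < ε) {φ : ℂ → ℂ} (hφ : DifferentiableOn ℂ φ U) {δ : ℝ} (hδ : 0 < δ) :
    ∃ p : Polynomial ℂ, ∀ w ∈ core U R ε, ‖p.eval w - φ w‖ < δ := by
  have hLc := isCompact_core U R ε
  have : CompactSpace (core U R ε) := isCompact_iff_compactSpace.1 hLc
  set A := (polynomialFunctions (core U R ε)).topologicalClosure with hA
  have hAc : IsClosed (A : Set C(core U R ε, ℂ)) := Subalgebra.isClosed_topologicalClosure _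
  have hid : (⟨fun w => w, continuous_subtype_val⟩ : C(core U R ε, ℂ)) ∈ A :=
    Subalgebra.le_topologicalClosure _ ⟨Polynomial.X, by simp, by ext; simp⟩
  obtain ⟨ψ, hψA, hψ⟩ := exists_mem_eq_of_kernelMem hLc hAc (fun z hz =>
    of_spread_of_hasNoHoles hUh hε (fun _ _ h h' => h.spread hLc hAc h')
      (fun z hz => kernelMem_of_norm_lt hLc hAc hid (fun _ hw => hw.1.trans_lt hz)
        (norm_pos_iff.1 (hR.trans hz))) hz) hUo (core_subset hε) hφ
  obtain ⟨g, ⟨p, -, rfl⟩, hg⟩ := Metric.mem_closure_iff.1 hψA δ hδ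
  refine ⟨p, fun w hw => ?_⟩
  have := (ContinuousMap.dist_lt_iff hδ).1 hg ⟨w, hw⟩
  rw [hψ, dist_comm, dist_eq_norm] at this
  simpa using this

/-- Approximate `φ` by a polynomial `p` within half its minimum modulus. Then `p` is zero-free on
the core and has a logarithm by factorization, while `φ / p` stays within `1` of `1`. -/
theorem hasLogOn_core {U : Set ℂ} (hUo : IsOpen U) (hUh : HasNoHoles U) {R ε : ℝ}
    (hR : 0 < R) (hε : 0 < ε) {φ : ℂ → ℂ} (hφ : DifferentiableOn ℂ φ U)
    (hφ0 : ∀ w ∈ core U R ε, φ w ≠ 0) : HasLogOn (core U R ε) φ := by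
  have hLc := isCompact_core U R ε
  have hφc : ContinuousOn φ (core U R ε) := hφ.continuousOn.mono (core_subset hε)
  rcases (core U R ε).eq_empty_or_nonempty with h | ⟨w₀, hw₀⟩
  · exact ⟨fun _ => 0, by simp [h], by simp [h]⟩
  obtain ⟨m, hm, hmle⟩ : ∃ m > 0, ∀ w ∈ core U R ε, m ≤ ‖φ w‖ := by
    obtain ⟨w, hw, hmin⟩ := hLc.exists_isMinOn ⟨w₀, hw₀⟩ hφc.norm
    exact ⟨‖φ w‖, norm_pos_iff.2 (hφ0 w hw), fun v hv => hmin hv⟩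
  obtain ⟨p, hp⟩ := exists_polynomial_near hUo hUh hR hε hφ (half_pos hm)
  have hlt : ∀ w ∈ core U R ε, m / 2 < ‖p.eval w‖ := fun w hw => by
    have h1 := hp w hw
    have h2 := hmle w hw
    have h3 := norm_sub_norm_le (φ w) (p.eval w)
    rw [norm_sub_rev] at h3
    linarith
  have hp0 : ∀ w ∈ core U R ε, p.eval w ≠ 0 := fun w hw =>
    norm_pos_iff.1 ((half_pos hm).trans (hlt w hw))
  have hpne : p ≠ 0 := by
    rintro rfl
    simpa using hp0 w₀ hw₀
  refine ((hasLogOn_polynomial_core hUh hR hε hpne hp0).mul (hasLogOn_of_norm_sub_one_lt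
    (φ := fun w => φ w / p.eval w) (hφc.div (by fun_prop) hp0) fun w hw => ?_)).congr
      fun w hw => mul_div_cancel₀ _ (hp0 w hw)
  rw [div_sub_one (hp0 w hw), norm_div, div_lt_one (norm_pos_iff.2 (hp0 w hw)), norm_sub_rev]
  exact (hp w hw).trans (hlt w hw)
end

/-! ### Holomorphic inverses and simultaneous approximation -/

noncomputable section

open Complex

theorem nhds_le_map_of_injOn {U : Set ℂ} (hU : IsOpen U) {g : ℂ → ℂ}
    (hg : DifferentiableOn ℂ g U) (hinj : InjOn g U) {z : ℂ} (hz : z ∈ U) :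
    (¬ ∀ᶠ y in 𝓝 z, g y = g z) ∧ 𝓝 (g z) ≤ map g (𝓝 z) := by
  have hnc : ¬ ∀ᶠ y in 𝓝 z, g y = g z := by
    intro h
    have h1 : ∀ᶠ y in 𝓝[≠] z, y = z := nhdsWithin_le_nhds <| by
      filter_upwards [h, hU.mem_nhds hz] with y hy hyU
      exact hinj hyU hz hy
    obtain ⟨y, hy, hy'⟩ := (h1.and self_mem_nhdsWithin).exists
    exact hy' hy
  exact ⟨hnc, ((hg.analyticAt (hU.mem_nhds hz)).eventually_constant_or_nhds_le_map_nhds).resolve_left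
    hnc⟩

theorem eventually_deriv_ne_zero {U : Set ℂ} (hU : IsOpen U) {g : ℂ → ℂ}
    (hg : DifferentiableOn ℂ g U) (hinj : InjOn g U) {z : ℂ} (hz : z ∈ U) :
    ∀ᶠ y in 𝓝[≠] z, deriv g y ≠ 0 := by
  refine ((hg.analyticAt (hU.mem_nhds hz)).deriv.eventually_eq_zero_or_eventually_ne_zero
    ).resolve_left fun h => (nhds_le_map_of_injOn hU hg hinj hz).1 ?_
  obtain ⟨r, hr, hb⟩ := Metric.mem_nhds_iff.1 (h.and (hU.mem_nhds hz))
  filter_upwards [Metric.ball_mem_nhds z hr] with y hy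
  exact Metric.isOpen_ball.is_const_of_deriv_eq_zero (convex_ball z r).isPreconnected
    (hg.mono fun x hx => (hb hx).2) (fun x hx => (hb hx).1) hy (Metric.mem_ball_self hr)

/-- The inverse of an injective holomorphic function is holomorphic on the image. -/
theorem exists_holomorphic_leftInverse {U : Set ℂ} (hU : IsOpen U) {g : ℂ → ℂ}
    (hg : DifferentiableOn ℂ g U) (hinj : InjOn g U) :
    IsOpen (g '' U) ∧ ∃ k : ℂ → ℂ, DifferentiableOn ℂ k (g '' U) ∧ ∀ z ∈ U, k (g z) = z := by
  have himg : ∀ z ∈ U, ∀ N ∈ 𝓝 z, g '' (N ∩ U) ∈ 𝓝 (g z) := fun z hz N hN =>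
    (nhds_le_map_of_injOn hU hg hinj hz).2 (image_mem_map (inter_mem hN (hU.mem_nhds hz)))
  have hopen : IsOpen (g '' U) := by
    rw [isOpen_iff_mem_nhds]
    rintro _ ⟨z, hz, rfl⟩
    exact mem_of_superset (himg z hz univ univ_mem) (image_mono inter_subset_right)
  set k := Function.invFunOn g U
  have hk : ∀ z ∈ U, k (g z) = z := fun z hz => hinj.leftInvOn_invFunOn hz
  have hcont : ∀ z ∈ U, ContinuousAt k (g z) := by
    intro z hz N hN
    rw [hk z hz] at hN
    refine mem_map.2 (mem_of_superset (himg z hz N hN) ?_)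
    rintro _ ⟨y, ⟨hyN, hyU⟩, rfl⟩
    rwa [mem_preimage, hk y hyU]
  have hdiff : ∀ z ∈ U, deriv g z ≠ 0 → DifferentiableAt ℂ k (g z) := by
    intro z hz hd
    refine (HasDerivAt.of_local_left_inverse (hcont z hz)
      (f' := deriv g z) (f := g) ?_ hd ?_).differentiableAt
    · rw [hk z hz]
      exact (hg.differentiableAt (hU.mem_nhds hz)).hasDerivAt
    · filter_upwards [hopen.mem_nhds (mem_image_of_mem g hz)]
      rintro _ ⟨y, hy, rfl⟩
      rw [hk y hy]
  refine ⟨hopen, k, ?_, hk⟩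
  rintro _ ⟨z, hz, rfl⟩
  -- Zeros of `deriv g` are isolated, so `k` is continuous with at most isolated, hence removable,
  -- singularities. That `deriv g` never vanishes need not be proved.
  refine (analyticAt_of_differentiable_on_punctured_nhds_of_continuousAt ?_
    (hcont z hz)).differentiableAt.differentiableWithinAt
  have h1 := eventually_nhdsWithin_iff.1 (eventually_deriv_ne_zero hU hg hinj hz)
  have h2 : Tendsto k (𝓝 (g z)) (𝓝 z) := by simpa [ContinuousAt, hk z hz] using hcont z hz
  rw [eventually_nhdsWithin_iff]
  filter_upwards [h2.eventually h1, hopen.mem_nhds (mem_image_of_mem g hz)]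
  rintro _ hy ⟨y, hyU, rfl⟩ hne
  rw [hk y hyU] at hy
  exact hdiff y hyU (hy fun h : y = z => hne (h ▸ rfl))

/-- The algebra of restrictions to `X` of the functions holomorphic on `Ω`. -/
def holAlgebra (Ω X : Set ℂ) : Subalgebra ℂ C(X, ℂ) where
  carrier := {φ | ∃ G : ℂ → ℂ, DifferentiableOn ℂ G Ω ∧ ∀ w : X, φ w = G w}
  mul_mem' := by
    rintro φ ψ ⟨G, hG, hφ⟩ ⟨H, hH, hψ⟩
    exact ⟨fun z => G z * H z, hG.mul hH, fun w => by simp [hφ, hψ]⟩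
  add_mem' := by
    rintro φ ψ ⟨G, hG, hφ⟩ ⟨H, hH, hψ⟩
    exact ⟨fun z => G z + H z, hG.add hH, fun w => by simp [hφ, hψ]⟩
  algebraMap_mem' c := ⟨fun _ => c, differentiableOn_const c, fun _ => rfl⟩

/-- If for every `z ∉ X` some `(w - z) / ψ w`, with `ψ` zero-free on `Ω`, has a continuous
logarithm on `X`, then the closure of `holAlgebra Ω X` contains all Cauchy kernels with pole
off `X`. -/
theorem kernelMem_holAlgebra {Ω X : Set ℂ} [CompactSpace X] (hX : IsCompact X) (hXΩ : X ⊆ Ω)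
    (hlog : ∀ z ∉ X, ∃ ψ : ℂ → ℂ, Continuous ψ ∧ (∀ w ∈ Ω, ψ w ≠ 0) ∧
      HasLogOn X fun w => (w - z) / ψ w) {z : ℂ} (hz : z ∉ X) :
    KernelMem (holAlgebra Ω X).topologicalClosure z := by
  by_contra hbad
  set A := (holAlgebra Ω X).topologicalClosure with hA
  have hAc : IsClosed (A : Set C(X, ℂ)) := Subalgebra.isClosed_topologicalClosure _
  have hid : (⟨fun w => w, continuous_subtype_val⟩ : C(X, ℂ)) ∈ A :=
    Subalgebra.le_topologicalClosure _ ⟨fun w => w, differentiableOn_id, fun _ => rfl⟩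
  have hP : ∀ z z', KernelMem A z → (∀ w ∈ X, ‖z' - z‖ < ‖z - w‖) → KernelMem A z' :=
    fun _ _ h h' => h.spread hX hAc h'
  -- The bad poles. A pole off `Ω` has its kernel in the algebra itself and a far pole is good, so
  -- `B` is a bounded subset of `Ω`; local constancy off `X` puts its frontier in `X`.
  set B : Set ℂ := {z | z ∉ X ∧ ¬ KernelMem A z} with hB
  have hBΩ : B ⊆ Ω := by
    intro y hy
    by_contra hyΩ
    have hne : ∀ w ∈ Ω, y - w ≠ 0 := fun w hw h => hyΩ (sub_eq_zero.1 h ▸ hw)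
    have hc : Continuous fun w : X => (y - w)⁻¹ :=
      Continuous.inv₀ (by fun_prop) fun w => hne w (hXΩ w.2)
    refine hy.2 ⟨⟨_, hc⟩, Subalgebra.le_topologicalClosure _ ⟨fun w => (y - w)⁻¹, ?_,
      fun _ => rfl⟩, fun w => inv_mul_cancel₀ (hne w (hXΩ w.2))⟩
    exact DifferentiableOn.inv (by fun_prop) hne
  have hBb : Bornology.IsBounded B := by
    obtain ⟨R, hR⟩ := hX.isBounded.subset_closedBall (0 : ℂ)
    refine (Metric.isBounded_closedBall (x := (0 : ℂ)) (r := max R 0)).subset fun y hy => ?_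
    rw [mem_closedBall_zero_iff]
    by_contra! h
    refine hy.2 (kernelMem_of_norm_lt hX hAc hid (fun w hw => ?_)
      (norm_pos_iff.1 ((le_max_right _ _).trans_lt h)))
    exact ((mem_closedBall_zero_iff.1 (hR hw)).trans (le_max_left _ _)).trans_lt h
  have hfr : frontier B ⊆ X := by
    intro y hy
    by_contra hyX
    rw [(isOpen_not_of_spread hX.isClosed hP).frontier_eq] at hy
    have hyK : KernelMem A y := by
      by_contra h
      exact hy.2 ⟨hyX, h⟩
    obtain ⟨x, hx1, hx2⟩ := mem_closure_iff.1 hy.1 _ (isOpen_of_spread hX.isClosed hP) ⟨hyX, hyK⟩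
    exact hx2.2 hx1.2
  have hcl : closure B ⊆ Ω := by
    rw [closure_eq_self_union_frontier]
    exact union_subset hBΩ (hfr.trans hXΩ)
  obtain ⟨ψ, hψ, hψ0, hl⟩ := hlog z hz
  exact not_hasLogOn_frontier hX.isClosed hBb hfr (z₀ := z) ⟨hz, hbad⟩ hψ.continuousOn
    (fun w hw => hψ0 w (hcl hw)) hl

/-- Simultaneous approximation of `g₀` on a compact subset of `Ω`, and of `h` along the injective
map `g` on a compact subset of `U`, by a function holomorphic on `Ω`. -/
theorem exists_holomorphic_near {Ω U : Set ℂ} (hΩ : IsOpen Ω) (hU : IsOpen U)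
    (hUh : HasNoHoles U) {R ε R' ε' : ℝ} (hR : 0 < R) (hε : 0 < ε) (hR' : 0 < R') (hε' : 0 < ε')
    {g : ℂ → ℂ} (hg : DifferentiableOn ℂ g U) (hinj : InjOn g U) (hgΩ : MapsTo g U Ω)
    (hdisj : Disjoint (core Ω R ε) (g '' core U R' ε')) {g₀ h : ℂ → ℂ}
    (hg₀ : DifferentiableOn ℂ g₀ Ω) (hh : DifferentiableOn ℂ h U) {δ : ℝ} (hδ : 0 < δ) :
    ∃ G : ℂ → ℂ, DifferentiableOn ℂ G Ω ∧ (∀ w ∈ core Ω R ε, ‖G w - g₀ w‖ < δ) ∧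
      ∀ z ∈ core U R' ε', ‖G (g z) - h z‖ < δ := by
  classical
  set K := core Ω R ε with hK
  set L := core U R' ε' with hL
  have hKc : IsCompact K := isCompact_core _ _ _
  have hLU : L ⊆ U := core_subset hε'
  have hLc : IsCompact (g '' L) :=
    (isCompact_core _ _ _).image_of_continuousOn (hg.continuousOn.mono hLU)
  obtain ⟨hopen, k, hk, hkg⟩ := exists_holomorphic_leftInverse hU hg hinj
  have hLsub : g '' L ⊆ g '' U := image_mono hLU
  have hX : IsCompact (K ∪ g '' L) := hKc.union hLc
  have : CompactSpace ↑(K ∪ g '' L) := isCompact_iff_compactSpace.1 hX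
  have hXΩ : K ∪ g '' L ⊆ Ω :=
    union_subset (core_subset hε) (hLsub.trans hgΩ.image_subset)
  -- Pulled back by `g`, this is a logarithm of the zero-free function `g - c` on the core of `U`.
  have hlogL : ∀ c ∉ g '' L, HasLogOn (g '' L) fun w => w - c := by
    intro c hc
    obtain ⟨l, hl, hl'⟩ := hasLogOn_core hU hUh hR' hε' (hg.sub_const c)
      fun w hw h => hc ⟨w, hw, sub_eq_zero.1 h⟩
    refine ⟨l ∘ k, hl.comp (hk.continuousOn.mono hLsub) ?_, ?_⟩
    · rintro _ ⟨y, hy, rfl⟩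
      rwa [hkg y (hLU hy)]
    · rintro _ ⟨y, hy, rfl⟩
      rw [Function.comp_apply, hkg y (hLU hy)]
      exact hl' y hy
  have hker : ∀ z ∉ K ∪ g '' L, KernelMem (holAlgebra Ω (K ∪ g '' L)).topologicalClosure z := by
    intro z hz
    refine kernelMem_holAlgebra hX hXΩ (fun z hz => ?_) hz
    have hzL := hlogL z fun h => hz (Or.inr h)
    -- For a far pole take `ψ = 1`; otherwise `ψ w = w - q` with `q ∉ Ω` close to `z`, so that `(w -
    -- z) / (w - q)` is close to `1` on `K`.
    rcases notMem_core fun h => hz (Or.inl h) with hzR | ⟨q, hq, hzq⟩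
    · refine ⟨fun _ => 1, continuous_const, fun _ _ => one_ne_zero, ?_⟩
      simp only [div_one]
      exact HasLogOn.union hKc.isClosed hLc.isClosed hdisj (hasLogOn_sub_of_norm_lt
        (fun w hw => hw.1.trans_lt hzR) (norm_pos_iff.1 (hR.trans hzR))) hzL
    · refine ⟨fun w => w - q, by fun_prop, fun w hw h => hq (sub_eq_zero.1 h ▸ hw), ?_⟩
      refine HasLogOn.union hKc.isClosed hLc.isClosed hdisj (hasLogOn_sub_div_sub fun w hw => ?_)
        (hzL.div (hlogL q fun h => hq (hXΩ (Or.inr h))))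
      exact hzq.trans_le (norm_sub_rev w q ▸ hw.2 q hq)
  obtain ⟨O₁, O₂, hO₁, hO₂, hKO, hLO, hOO⟩ := SeparatedNhds.of_isCompact_isCompact hKc hLc hdisj
  -- The target for Runge: `g₀` near `K` and `h ∘ g⁻¹` near `g(L)`.
  set F : ℂ → ℂ := O₁.piecewise g₀ (h ∘ k) with hF
  have hF1 : EqOn F g₀ O₁ := O₁.piecewise_eqOn _ _
  have hF2 : EqOn F (h ∘ k) O₂ := (O₁.piecewise_eqOn_compl _ _).mono hOO.subset_compl_left
  have hkU : MapsTo k (g '' U) U := by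
    rintro _ ⟨y, hy, rfl⟩
    rwa [hkg y hy]
  have hFd : DifferentiableOn ℂ F (O₁ ∩ Ω ∪ O₂ ∩ g '' U) := by
    refine DifferentiableOn.union_of_isOpen ((hg₀.mono inter_subset_right).congr
      (hF1.mono inter_subset_left)) (((hh.comp hk hkU).mono inter_subset_right).congr
      (hF2.mono inter_subset_left)) (hO₁.inter hΩ) (hO₂.inter hopen)
  obtain ⟨φ, hφA, hφ⟩ := exists_mem_eq_of_kernelMem hX (Subalgebra.isClosed_topologicalClosure _)
    hker ((hO₁.inter hΩ).union (hO₂.inter hopen)) (union_subset_union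
      (subset_inter hKO (core_subset hε)) (subset_inter hLO hLsub)) hFd
  obtain ⟨γ, ⟨G, hG, hγ⟩, hdist⟩ := Metric.mem_closure_iff.1 hφA δ hδ
  have hGF : ∀ w ∈ K ∪ g '' L, ‖G w - F w‖ < δ := fun w hw => by
    have := (ContinuousMap.dist_lt_iff hδ).1 hdist ⟨w, hw⟩
    rwa [hφ, hγ, dist_comm, dist_eq_norm] at this
  refine ⟨G, hG, fun w hw => ?_, fun z hz => ?_⟩
  · rw [← hF1 (hKO hw)]
    exact hGF w (Or.inl hw)
  · have h1 := hGF (g z) (Or.inr ⟨z, hz, rfl⟩)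
    rwa [hF2 (hLO ⟨z, hz, rfl⟩), Function.comp_apply, hkg z (hLU hz)] at h1
end

/-! ### Chordal distance to the boundary, and the space of holomorphic functions -/

noncomputable section

/-- The sphere is connected and `∞ ∉ Ω`. Without this, `chordalInfDist` would take the default value
`0` of an empty infimum. -/
theorem sphereBoundary_nonempty {Ω : Set ℂ} (hne : Ω.Nonempty) : (sphereBoundary Ω).Nonempty := by
  refine nonempty_frontier_iff.2 ⟨hne.image _, fun h => ?_⟩
  obtain ⟨z, -, hz⟩ : OnePoint.infty ∈ toSphere Ω := h ▸ mem_univ _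
  exact OnePoint.coe_ne_infty z hz

theorem notMem_of_coe_mem_sphereBoundary {Ω : Set ℂ} (hΩ : IsOpen Ω) {z : ℂ}
    (hz : (z : OnePoint ℂ) ∈ sphereBoundary Ω) : z ∉ Ω := fun h => by
  have ho : IsOpen (toSphere Ω) := OnePoint.isOpen_image_coe.2 hΩ
  rw [sphereBoundary, ho.frontier_eq] at hz
  exact hz.2 ⟨z, h, rfl⟩

theorem sqrt_one_add_sq_le {t s : ℝ} (ht : 0 ≤ t) (hts : t ≤ s) : √(1 + t ^ 2) ≤ 1 + s := by
  rw [Real.sqrt_le_left (by linarith)]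
  nlinarith

/-- Points of `core Ω R ε` are uniformly far from the boundary of `Ω` in the chordal metric. -/
theorem exists_le_chordalInfDist {Ω : Set ℂ} (hΩ : IsOpen Ω) (hne : Ω.Nonempty) {R ε : ℝ}
    (hR : 0 < R) (hε : 0 < ε) :
    ∃ c > 0, ∀ z ∈ core Ω R ε, c ≤ chordalInfDist (z : OnePoint ℂ) (sphereBoundary Ω) := by
  -- The first bound is for the boundary point `∞`. The second, for finite ones, is the value at `t
  -- = ε` of the increasing function `2t / ((1 + R)(1 + R + t))`.
  refine ⟨min (2 / (1 + R)) (2 * ε / ((1 + R) * (1 + R + ε))), by positivity, fun z hz => ?_⟩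
  refine le_csInf ((sphereBoundary_nonempty hne).image _) ?_
  rintro _ ⟨b, hb, rfl⟩
  have hz1 : √(1 + ‖z‖ ^ 2) ≤ 1 + R := sqrt_one_add_sq_le (norm_nonneg _) hz.1
  induction b using OnePoint.rec with
  | infty =>
    refine (min_le_left _ _).trans ?_
    change _ ≤ 2 / √(1 + ‖z‖ ^ 2)
    gcongr
  | coe w =>
    refine (min_le_right _ _).trans ?_
    change _ ≤ 2 * ‖z - w‖ / (√(1 + ‖z‖ ^ 2) * √(1 + ‖w‖ ^ 2))
    have hd := hz.2 w (notMem_of_coe_mem_sphereBoundary hΩ hb)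
    set d := ‖z - w‖
    have hw : ‖w‖ ≤ R + d := by
      have := norm_sub_norm_le w z
      rw [norm_sub_rev] at this
      linarith [hz.1]
    have hw1 : √(1 + ‖w‖ ^ 2) ≤ 1 + R + d := by
      have := sqrt_one_add_sq_le (norm_nonneg w) hw
      linarith
    calc 2 * ε / ((1 + R) * (1 + R + ε)) ≤ 2 * d / ((1 + R) * (1 + R + d)) := by
          rw [div_le_div_iff₀ (by positivity) (by positivity)]
          have : 0 ≤ (1 + R) * (1 + R) * (d - ε) :=
            mul_nonneg (by positivity) (sub_nonneg.2 hd)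
          linarith
      _ ≤ 2 * d / (√(1 + ‖z‖ ^ 2) * √(1 + ‖w‖ ^ 2)) := by gcongr

theorem eventually_disjoint_core {Ω U L : Set ℂ} (hΩ : IsOpen Ω) (hne : Ω.Nonempty)
    (hU : IsOpen U) (hL : IsCompact L) (hLU : L ⊆ U) {F : ℕ → ℂ → ℂ}
    (hconv : TendstoLocallyUniformlyOn
      (fun n z => chordalInfDist (F n z : OnePoint ℂ) (sphereBoundary Ω)) (fun _ => (0 : ℝ))
      atTop U) {R ε : ℝ} (hR : 0 < R) (hε : 0 < ε) :
    ∀ᶠ n in atTop, Disjoint (core Ω R ε) (F n '' L) := by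
  obtain ⟨c, hc, hle⟩ := exists_le_chordalInfDist hΩ hne hR hε
  have h := (tendstoLocallyUniformlyOn_iff_forall_isCompact hU).1 hconv L hLU hL
  filter_upwards [Metric.tendstoUniformlyOn_iff.1 h c hc] with n hn
  rw [disjoint_right]
  rintro _ ⟨z, hz, rfl⟩ hzK
  have h1 := hn z hz
  rw [Real.dist_eq, zero_sub, abs_neg] at h1
  exact ((hle _ hzK).trans (le_abs_self _)).not_gt h1

/-- Weierstrass' theorem on locally uniform limits, applied to extensions by zero. -/
theorem isClosed_holFun {Ω : Set ℂ} (hΩ : IsOpen Ω) : IsClosed (HolFun Ω) := by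
  have := hΩ.locallyCompactSpace
  refine isClosed_of_closure_subset fun g hg => ?_
  have hne : (𝓝[HolFun Ω] g).NeBot := mem_closure_iff_nhdsWithin_neBot.1 hg
  set E : C(Ω, ℂ) → ℂ → ℂ := fun φ => Function.extend Subtype.val φ 0 with hE
  have hEv : ∀ φ : C(Ω, ℂ), ∀ z : Ω, E φ z = φ z := fun φ z =>
    Subtype.val_injective.extend_apply _ _ _
  have hlim : TendstoLocallyUniformlyOn E (E g) (𝓝[HolFun Ω] g) Ω := by
    rw [tendstoLocallyUniformlyOn_iff_tendstoLocallyUniformly_comp_coe]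
    have h1 : Tendsto (fun φ : C(Ω, ℂ) => φ) (𝓝[HolFun Ω] g) (𝓝 g) := nhdsWithin_le_nhds
    have h2 := ContinuousMap.tendsto_iff_tendstoLocallyUniformly.1 h1
    convert h2 using 1
    · ext φ z
      exact hEv φ z
    · ext z
      exact hEv g z
  refine ⟨E g, hlim.differentiableOn ?_ hΩ, fun z => (hEv g z).symm⟩
  filter_upwards [self_mem_nhdsWithin]
  rintro φ ⟨G, hG, hφ⟩
  refine hG.congr fun z hz => ?_
  rw [← hφ ⟨z, hz⟩, ← hEv φ ⟨z, hz⟩]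

theorem baireSpace_holFun {Ω : Set ℂ} (hΩ : IsOpen Ω) : BaireSpace (HolFun Ω) := by
  have := hΩ.locallyCompactSpace
  have : CompleteSpace (HolFun Ω) := (isClosed_holFun hΩ).isComplete.completeSpace_coe
  infer_instance

theorem exists_core_nhds {M : Set ℂ} (hM : IsOpen M) {φ : C(M, ℂ)} {V : Set C(M, ℂ)}
    (hV : V ∈ 𝓝 φ) : ∃ R > 0, ∃ ε > 0, ∃ δ > 0,
      ∀ ψ : C(M, ℂ), (∀ w : M, (w : ℂ) ∈ core M R ε → ‖ψ w - φ w‖ < δ) → ψ ∈ V := by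
  obtain ⟨⟨K, δ⟩, ⟨hK, hδ⟩, hsub⟩ := (nhds_basis_uniformity'
    Metric.uniformity_basis_dist.compactConvergenceUniformity).mem_iff.1 hV
  obtain ⟨R, hR, ε, hε, hcore⟩ := exists_subset_core hM (hK.image continuous_subtype_val)
    (Subtype.coe_image_subset M K)
  refine ⟨R, hR, ε, hε, δ, hδ, fun ψ h => hsub ?_⟩
  intro w hw
  have := h w (hcore ⟨w, hw, rfl⟩)
  change dist (φ w) (ψ w) < δ
  rwa [dist_comm, dist_eq_norm]

end

/-! ### The Baire category argument -/

theorem mainTheorem1 (Ω D U : Set ℂ) (f : ℂ → ℂ)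
    (hΩ : IsOpen Ω) (hΩc : IsConnected Ω)
    (hD : IsOpen D) (hDΩ : D ⊆ Ω)
    (hf : DifferentiableOn ℂ f D) (hfD : MapsTo f D D)
    (hU : IsOpen U) (hUD : U ⊆ D) (hUh : HasNoHoles U)
    (hinj : ∀ n : ℕ, 1 ≤ n → InjOn (f^[n]) U)
    (hconv : TendstoLocallyUniformlyOn
      (fun (n : ℕ) (z : ℂ) => chordalInfDist ((f^[n] z : ℂ) : OnePoint ℂ) (sphereBoundary Ω))
      (fun _ => (0 : ℝ)) atTop U) :
    IsComeager {g : HolFun Ω |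
      IsUniversal hf.continuousOn hfD hDΩ hUD (HolFun U) (g : C(Ω, ℂ))} := by
  have := hΩ.locallyCompactSpace
  have := hU.locallyCompactSpace
  have := baireSpace_holFun hΩ
  have hiter : ∀ n : ℕ, DifferentiableOn ℂ (f^[n]) U := fun n => (hf.iterate hfD n).mono hUD
  set b := TopologicalSpace.countableBasis C(U, ℂ) with hb
  have hbasis : TopologicalSpace.IsTopologicalBasis b :=
    TopologicalSpace.isBasis_countableBasis _
  -- Universality only concerns the closure at points of `H(U)`, so only basic sets meeting `H(U)`
  -- are to be hit.
  set I : Set (Set C(U, ℂ)) := {V ∈ b | (V ∩ HolFun U).Nonempty} with hI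
  have hIc : I.Countable := (TopologicalSpace.countable_countableBasis _).mono fun _ h => h.1
  set G : Set C(U, ℂ) → Set (HolFun Ω) := fun V => ⋃ n ∈ {n : ℕ | 1 ≤ n},
    {g | (g : C(Ω, ℂ)).comp (iterateOn hf.continuousOn hfD hDΩ hUD n) ∈ V} with hG
  have hGo : ∀ V ∈ I, IsOpen (G V) := fun V hV => isOpen_biUnion fun n _ =>
    (hbasis.isOpen hV.1).preimage
      ((ContinuousMap.continuous_precomp _).comp continuous_subtype_val)
  refine ⟨⋂ V ∈ I, G V, ?_, IsGδ.biInter hIc fun V hV => (hGo V hV).isGδ,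
    dense_biInter_of_isOpen hGo hIc ?_⟩
  · intro g hg φ hφ
    refine hbasis.mem_closure_iff.2 fun V hV hφV => ?_
    obtain ⟨n, hn, hgn⟩ := mem_iUnion₂.1 (mem_iInter₂.1 hg V ⟨hV, φ, hφV, hφ⟩)
    exact ⟨_, hgn, n, hn, rfl⟩
  · rintro V ⟨hVb, h, hhV, hh, hhd, hhe⟩
    refine dense_iff_inter_open.2 ?_
    rintro _ ⟨O, hO, rfl⟩ ⟨⟨γ, g₀, hg₀d, hg₀e⟩, hγO⟩
    obtain ⟨R, hR, ε, hε, δ, hδ, hnear⟩ := exists_core_nhds hΩ (hO.mem_nhds hγO)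
    obtain ⟨R', hR', ε', hε', δ', hδ', hnear'⟩ :=
      exists_core_nhds hU ((hbasis.isOpen hVb).mem_nhds hhV)
    -- Such an `n` separates the two cores; `n ≥ 1` gives injectivity and is required by
    -- universality.
    obtain ⟨n, hn, hn1⟩ := ((eventually_disjoint_core hΩ hΩc.nonempty hU (isCompact_core U R' ε')
      (core_subset hε') hconv hR hε).and (eventually_ge_atTop 1)).exists
    obtain ⟨F, hF, hF1, hF2⟩ := exists_holomorphic_near hΩ hU hUh hR hε hR' hε' (hiter n)
      (hinj n hn1) (fun z hz => hDΩ (hfD.iterate n (hUD hz))) hn hg₀d hhd (lt_min hδ hδ')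
    let φ : C(Ω, ℂ) := ⟨fun z => F z, continuousOn_iff_continuous_domRestrict.1 hF.continuousOn⟩
    refine ⟨⟨φ, F, hF, fun _ => rfl⟩, hnear φ fun w hw => ?_,
      mem_iUnion₂.2 ⟨n, hn1, hnear' _ fun w hw => ?_⟩⟩
    · rw [hg₀e w]
      exact (hF1 w hw).trans_le (min_le_left _ _)
    · rw [hhe w]
      exact (hF2 w hw).trans_le (min_le_right _ _)
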